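/- Let $p$ be a prime number. For a finite set $X$ and $F\in\mathbb{C}^X$ write $\|F\|_0=|\{x\in X: F(x)\neq 0\}|$. Let $\widehat{\mathbb{Z}_p}$ be the group of characters of $\mathbb{Z}_p$, and for $f,g\in\mathbb{C}^{\mathbb{Z}_p}$ let $V_gf\in\mathbb{C}^{\mathbb{Z}_p\times\widehat{\mathbb{Z}_p}}$ be the short-time Fourier transform $$V_gf(x,\xi)=\sum_{y\in\mathbb{Z}_p} f(y)\,\overline{g(y-x)}\,\overline{\xi(y)},\qquad (x,\xi)\in\mathbb{Z}_p\times\widehat{\mathbb{Z}_p}.$$ Then there exists $g\in\mathbb{C}^{\mathbb{Z}_p}$ with $|g(x)|=1$ for all $x\in\mathbb{Z}_p$ such that 1. $\|f\|_0+\|V_gf\|_0\ge p^2+1$ for all $f\in\mathbb{C}^{\mathbb{Z}_p}\setminus\{0\}$; and 2. for all integers $k,l$ with $1\le k\le p$, $1\le l\le p^2$ and $k+l\ge p^2+1$, there exists $f\in\mathbb{C}^{\mathbb{Z}_p}$ with $\|f\|_0=k$ and $\|V_gf\|_0=l$. -/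

import Mathlib

open scoped ComplexConjugate

/-- `‖f‖₀`, the cardinality of the support of a complex function on a finite type. -/
noncomputable def supportSize {ι : Type*} [Finite ι] (f : ι → ℂ) : ℕ :=
  (Function.support f).ncard

/-- The translation operator `T_x`, given by `T_x f (y) = f (y - x)`. -/
def translation {G : Type*} [AddCommGroup G] (x : G) (f : G → ℂ) : G → ℂ :=
  fun y => f (y - x)

/-- The modulation operator `M_ξ`, given by pointwise multiplication with the character `ξ`.
The dual group of a finite Abelian group `G` is `AddChar G ℂ`. -/
def modulation {G : Type*} [AddCommGroup G] (ξ : AddChar G ℂ) (f : G → ℂ) : G → ℂ :=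
  fun y => ξ y * f y

/-- The time-frequency shift `π(x, ξ) = M_ξ ∘ T_x`. -/
def timeFreqShift {G : Type*} [AddCommGroup G] (lam : G × AddChar G ℂ) (f : G → ℂ) : G → ℂ :=
  modulation lam.2 (translation lam.1 f)

/-- The short-time Fourier transform `V_g f (x, ξ) = ⟨f, π(x, ξ) g⟩` with window `g`, where
`⟨f, h⟩ = ∑ y, f y * conj (h y)`. -/
noncomputable def stft {G : Type*} [AddCommGroup G] [Fintype G] (g f : G → ℂ) :
    G × AddChar G ℂ → ℂ :=
  fun lam => ∑ y, f y * conj (timeFreqShift lam g y)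

/-- The coordinate formula for the short-time Fourier transform. -/
theorem stft_apply {G : Type*} [AddCommGroup G] [Fintype G] (g f : G → ℂ) (x : G)
    (ξ : AddChar G ℂ) :
    stft g f (x, ξ) = ∑ y, f y * conj (g (y - x)) * conj (ξ y) := by
  simp only [stft, timeFreqShift, modulation, translation, map_mul]
  exact Finset.sum_congr rfl fun y _ => by ring

/-! Both claims follow once every square minor of the `p ^ 2 × p` matrix of conjugated
time-frequency shifts of `g` is nonzero. Take `conj (g a) = t ^ expWeight p a` with `‖t‖ = 1`: each
minor is then a polynomial in `t`, so all but finitely many `t` work provided no such polynomial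
vanishes identically. The terms of the determinant are matchings of sample points with translations.
The rapidly decreasing weights force all heaviest matchings to pair each sample with the same
translation, so the top coefficient is a block determinant whose blocks are minors of the Fourier
matrix, nonzero by `chebotarev`. Nonzero minors give the uncertainty bound; dimension counting and
general position give the prescribed support sizes. -/

/-! ### Chebotarev's theorem on minors of the Fourier matrix -/

open Polynomial in
/-- A nonzero sparse polynomial with `n` terms, whose exponents are distinct in the field, has no
root of multiplicity `n` at `1`. -/
theorem sparse_coeff_eq_zero {κ : Type*} [Field κ] (S : Finset ℕ) :
    ∀ a : ℕ → κ, (∀ s ∈ S, ∀ t ∈ S, (s : κ) = t → s = t) →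
      (X - 1 : κ[X]) ^ S.card ∣ ∑ s ∈ S, C (a s) * X ^ s → ∀ s ∈ S, a s = 0 := by
  classical
  induction S using Finset.induction_on with
  | empty => simp
  | insert s S hs ih =>
    intro a hinj hdvd
    have hS : ∀ j ∈ S, a j = 0 := by
      have h1 : (X - 1 : κ[X]) ^ S.card ∣ ∑ j ∈ S, C (((j : κ) - s) * a j) * X ^ j := by
        set P : κ[X] := ∑ j ∈ insert s S, C (a j) * X ^ j with hP
        have hder : (X - 1 : κ[X]) ^ S.card ∣ derivative P := by
          have := pow_sub_one_dvd_derivative_of_pow_dvd hdvd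
          rwa [Finset.card_insert_of_notMem hs, Nat.add_sub_cancel] at this
        have hP' : (X - 1 : κ[X]) ^ S.card ∣ P := by
          refine (pow_dvd_pow _ ?_).trans hdvd
          exact Finset.card_le_card (Finset.subset_insert _ _)
        -- The operator `X * d/dX - s` kills the term of exponent `s` and lowers the order of
        -- vanishing at `1` by at most one.
        have key : X * derivative P - C (s : κ) * P =
            ∑ j ∈ insert s S, C (((j : κ) - s) * a j) * X ^ j := by
          rw [hP, derivative_sum, Finset.mul_sum, Finset.mul_sum, ← Finset.sum_sub_distrib]
          refine Finset.sum_congr rfl fun j _ => ?_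
          rcases j with _ | j
          · simp
          · simp only [derivative_mul, derivative_C, derivative_X_pow, C_mul, C_sub]
            simp only [Nat.add_sub_cancel]
            ring
        rw [Finset.sum_insert hs, sub_self, zero_mul, C_0, zero_mul, zero_add] at key
        rw [← key]
        exact dvd_sub (hder.mul_left _) (hP'.mul_left _)
      intro j hj
      have := ih (fun j => ((j : κ) - s) * a j)
        (fun i hi j hj => hinj i (Finset.mem_insert_of_mem hi) j (Finset.mem_insert_of_mem hj)) h1 j hj
      refine (mul_eq_zero.1 this).resolve_left fun h => hs ?_
      rw [← hinj j (Finset.mem_insert_of_mem hj) s (Finset.mem_insert_self _ _) (sub_eq_zero.1 h)]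
      exact hj
    have hs0 : a s = 0 := by
      rw [Finset.sum_insert hs, Finset.sum_eq_zero (fun j hj => by rw [hS j hj]; simp), add_zero,
        Finset.card_insert_of_notMem hs] at hdvd
      have := eval_dvd (x := 1) ((dvd_pow_self _ (Nat.succ_ne_zero _)).trans hdvd)
      simpa using this
    intro j hj
    rcases Finset.mem_insert.1 hj with rfl | hj
    exacts [hs0, hS j hj]

/-- `p` generates a proper ideal of `ℤ`, which some valuation ring of `ℂ` dominates; its residue
field then has characteristic `p`. -/
theorem exists_valuationSubring_nonunit (p : ℕ) [hp : Fact p.Prime] :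
    ∃ V : ValuationSubring ℂ, (p : ℂ) ∈ V.nonunits := by
  let A : Subring ℂ := (Int.castRingHom ℂ).range
  have hI : Ideal.span {(p : A)} ≠ ⊤ := by
    intro h
    obtain ⟨⟨_, n, rfl⟩, hn⟩ := (Ideal.span_singleton_eq_top.1 h).exists_right_inv
    have hn : (p : ℂ) * (n : ℂ) = 1 := by simpa using congrArg A.subtype hn
    have hn : (p : ℤ) * n = 1 := by exact_mod_cast hn
    have := Int.eq_one_or_neg_one_of_mul_eq_one hn
    have := hp.out.two_le
    omega
  obtain ⟨V, -, hV⟩ := Ideal.image_subset_nonunits_valuationSubring _ hI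
  exact ⟨V, hV ⟨p, Ideal.subset_span rfl, by simp⟩⟩

open Polynomial in
/-- Chebotarev's theorem on roots of unity of prime order: if a combination of the powers
`z ^ s`, `s ∈ S`, vanishes at no fewer than `|S|` of the `p`-th roots of unity, it is trivial. -/
theorem chebotarev (p : ℕ) [hp : Fact p.Prime] (S : Finset (ZMod p)) (R : Finset ℂ)
    (hR : ∀ z ∈ R, z ^ p = 1) (hSR : S.card ≤ R.card) (a : ZMod p → ℂ)
    (h : ∀ z ∈ R, ∑ s ∈ S, a s * z ^ s.val = 0) : ∀ s ∈ S, a s = 0 := by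
  classical
  by_contra! hne
  obtain ⟨s₁, hs₁, has₁⟩ := hne
  obtain ⟨V, hV⟩ := exists_valuationSubring_nonunit p
  -- Dividing by the coefficient of largest valuation makes all coefficients integral and one of
  -- them `1`, so the reduction stays nonzero.
  obtain ⟨s₀, hs₀, hmax⟩ := S.exists_max_image (fun s => V.valuation (a s)) ⟨s₁, hs₁⟩
  have has₀ : a s₀ ≠ 0 := by
    intro h0
    have := hmax s₁ hs₁
    simp only [h0, map_zero, le_zero_iff, map_eq_zero] at this
    exact has₁ this
  have hb : ∀ s, ∃ b : V, s ∈ S → (b : ℂ) = a s / a s₀ := by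
    intro s
    by_cases hs : s ∈ S
    · refine ⟨⟨a s / a s₀, ?_⟩, fun _ => rfl⟩
      rw [← V.valuation_le_one_iff, map_div₀]
      exact div_le_one_of_le₀ (hmax s hs) zero_le
    · exact ⟨0, fun h => absurd h hs⟩
  choose b hb using hb
  have hRV : ∀ z ∈ R, z ∈ V := by
    intro z hz
    rcases V.mem_or_inv_mem z with h | h
    · exact h
    · have hz0 : z ≠ 0 := by
        rintro rfl
        simpa [hp.out.ne_zero] using hR 0 hz
      have : z = z⁻¹ ^ (p - 1) := by
        apply mul_right_cancel₀ (pow_ne_zero (p - 1) hz0)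
        rw [inv_pow, inv_mul_cancel₀ (pow_ne_zero _ hz0), ← pow_succ',
          Nat.sub_add_cancel hp.out.one_le, hR z hz]
      rw [this]
      exact pow_mem h _
  let R' : Finset V := R.subtype (· ∈ V)
  have hcard : R'.card = R.card := by
    rw [Finset.card_subtype, Finset.filter_true_of_mem hRV]
  have hR' : ∀ z ∈ R', (z : ℂ) ∈ R := fun z hz => Finset.mem_subtype.1 hz
  let Q : V[X] := ∑ s ∈ S, C (b s) * X ^ s.val
  have hQ : ∀ z ∈ R', Q.eval z = 0 := by
    intro z hz
    apply Subtype.val_injective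
    have h1 := h z (hR' z hz)
    simp only [Q, eval_finsetSum, eval_mul, eval_C, eval_pow, eval_X]
    push_cast
    calc ∑ s ∈ S, (b s : ℂ) * (z : ℂ) ^ s.val
        = (∑ s ∈ S, a s * (z : ℂ) ^ s.val) / a s₀ := by
          rw [Finset.sum_div]
          exact Finset.sum_congr rfl fun s hs => by rw [hb s hs]; ring
      _ = 0 := by rw [h1, zero_div]
  have hdvd : ∏ z ∈ R', (X - C z) ∣ Q := by
    by_cases hQ0 : Q = 0
    · rw [hQ0]
      exact dvd_zero _
    · refine (Multiset.prod_X_sub_C_dvd_iff_le_roots hQ0 R'.val).2 ?_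
      rw [Multiset.le_iff_subset R'.nodup]
      exact fun z hz => (mem_roots hQ0).2 (hQ z hz)
  let κ := IsLocalRing.ResidueField V
  let φ : V →+* κ := IsLocalRing.residue V
  have hpκ : (p : κ) = 0 := by
    have : φ (p : V) = 0 := by
      rw [IsLocalRing.residue_eq_zero_iff]
      obtain ⟨h, hm⟩ := ValuationSubring.mem_nonunits_iff_exists_mem_maximalIdeal.1 hV
      exact hm
    simpa using this
  have : CharP κ p := (CharP.charP_iff_prime_eq_zero hp.out).2 hpκ
  have : Fact p.Prime := hp
  -- By Frobenius all `p`-th roots of unity collapse to `1`, so distinct roots of `Q` merge into one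
  -- multiple root.
  have hz1 : ∀ z ∈ R', φ z = 1 := by
    intro z hz
    have h1 : z ^ p = 1 := Subtype.val_injective (by simpa using hR z (hR' z hz))
    have h2 : (φ z - 1) ^ p = 0 := by
      rw [sub_pow_char, one_pow, ← map_pow, h1, map_one, sub_self]
    exact sub_eq_zero.1 (pow_eq_zero_iff hp.out.ne_zero |>.1 h2)
  have hdvd' : (X - 1 : κ[X]) ^ R.card ∣ Q.map φ := by
    have := map_dvd (mapRingHom φ) hdvd
    rw [map_prod, Finset.prod_congr rfl (g := fun _ => (X - 1 : κ[X])), Finset.prod_const, hcard]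
      at this
    · simpa using this
    · intro z hz
      simp [hz1 z hz]
  let T : Finset ℕ := S.map ⟨ZMod.val, ZMod.val_injective p⟩
  have hval : ∀ s : ZMod p, ((s.val : ℕ) : ZMod p) = s := ZMod.natCast_zmod_val
  have := sparse_coeff_eq_zero T (fun n => φ (b (n : ZMod p))) ?_ ?_ s₀.val
    (Finset.mem_map_of_mem _ hs₀)
  · have hb1 : b s₀ = 1 := Subtype.val_injective (by simp [hb s₀ hs₀, has₀])
    simp [hb1] at this
  · intro s hs t ht hst
    obtain ⟨s, -, rfl⟩ := Finset.mem_map.1 hs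
    obtain ⟨t, -, rfl⟩ := Finset.mem_map.1 ht
    exact CharP.natCast_injOn_Iio κ p (ZMod.val_lt s) (ZMod.val_lt t) hst
  · have hT : T.card = S.card := Finset.card_map _
    rw [hT]
    refine (pow_dvd_pow _ hSR).trans (hdvd'.trans (dvd_of_eq ?_))
    simp [Q, T, Polynomial.map_sum]

/-! ### Matchings of maximal weight -/

/-- Rapidly decreasing weights on `ZMod p`: each weight exceeds the sum of any two later ones. -/
def expWeight (p : ℕ) (d : ZMod p) : ℕ := 3 ^ (p - d.val)

theorem expWeight_add_lt {p : ℕ} [NeZero p] {a b c : ZMod p} (ha : c.val < a.val)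
    (hb : c.val < b.val) : expWeight p a + expWeight p b < expWeight p c := by
  have hap := ZMod.val_lt a
  have h1 : expWeight p a ≤ 3 ^ (p - c.val - 1) := Nat.pow_le_pow_right (by norm_num) (by omega)
  have h2 : expWeight p b ≤ 3 ^ (p - c.val - 1) := Nat.pow_le_pow_right (by norm_num) (by omega)
  have h3 : expWeight p c = 3 * 3 ^ (p - c.val - 1) := by
    rw [expWeight, ← pow_succ']
    congr 1
    omega
  have h4 : 0 < 3 ^ (p - c.val - 1) := by positivity
  omega

/-- The total weight of the matching `σ` between the points `y` and the points `x`. -/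
def matchingWeight {p n : ℕ} (y x : Fin n → ZMod p) (σ : Equiv.Perm (Fin n)) : ℕ :=
  ∑ i, expWeight p (y i - x (σ i))

theorem card_filter_comp_perm {n : ℕ} {β : Type*} [DecidableEq β] (x : Fin n → β)
    (σ : Equiv.Perm (Fin n)) (b : β) :
    (Finset.univ.filter fun i => x (σ i) = b).card = (Finset.univ.filter fun i => x i = b).card :=
  Finset.card_equiv σ (by simp)

/-- Exchange argument: `σ` sends some other `j` to the point `x (τ i)`. Swapping `i` and `j` creates
the pair `(y i, x (τ i))`, whose weight alone exceeds the two weights lost. -/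
theorem exists_matchingWeight_lt {p n : ℕ} [NeZero p] {y x : Fin n → ZMod p}
    (hy : Function.Injective y) (σ τ : Equiv.Perm (Fin n)) (i : Fin n) (hi : x (σ i) ≠ x (τ i))
    (hmin : ∀ j, x (σ j) ≠ x (τ j) → (y i - x (τ i)).val ≤ (y j - x (σ j)).val) :
    ∃ ρ, matchingWeight y x σ < matchingWeight y x ρ := by
  obtain ⟨j, hj, hj'⟩ : ∃ j, x (σ j) = x (τ i) ∧ x (τ j) ≠ x (τ i) := by
    -- Otherwise the fibres of `x ∘ σ` and `x ∘ τ` over `x (τ i)`, being equinumerous, would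
    -- coincide, and `i` lies only in the second.
    by_contra! hcon
    have hsub : (Finset.univ.filter fun j => x (σ j) = x (τ i)) ⊆
        Finset.univ.filter fun j => x (τ j) = x (τ i) := by
      intro j hj
      simpa using hcon j (by simpa using hj)
    have heq := Finset.eq_of_subset_of_card_le hsub
      (by rw [card_filter_comp_perm, card_filter_comp_perm])
    have : i ∈ Finset.univ.filter fun j => x (σ j) = x (τ i) := by
      rw [heq]
      simp
    exact hi (by simpa using this)
  have hij : i ≠ j := by
    rintro rfl
    exact hi hj
  have h1 : (y i - x (τ i)).val < (y i - x (σ i)).val := by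
    refine lt_of_le_of_ne (hmin i hi) fun h => hi ?_
    exact (sub_right_injective (ZMod.val_injective p h)).symm
  have h2 : (y i - x (τ i)).val < (y j - x (σ j)).val := by
    refine lt_of_le_of_ne (hmin j (by rw [hj]; exact hj'.symm)) fun h => hij (hy ?_)
    rw [hj] at h
    exact sub_left_injective (ZMod.val_injective p h)
  refine ⟨σ * Equiv.swap i j, ?_⟩
  have hsplit : ∀ f : Fin n → ℕ, ∑ k, f k = f i + f j + ∑ k ∈ ({i, j} : Finset (Fin n))ᶜ, f k := by
    intro f
    rw [← Finset.sum_add_sum_compl {i, j}, Finset.sum_pair hij]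
  have hrest : ∑ k ∈ ({i, j} : Finset (Fin n))ᶜ,
      expWeight p (y k - x ((σ * Equiv.swap i j) k)) =
      ∑ k ∈ ({i, j} : Finset (Fin n))ᶜ, expWeight p (y k - x (σ k)) := by
    refine Finset.sum_congr rfl fun k hk => ?_
    simp only [Finset.mem_compl, Finset.mem_insert, Finset.mem_singleton, not_or] at hk
    rw [Equiv.Perm.mul_apply, Equiv.swap_apply_of_ne_of_ne hk.1 hk.2]
  rw [matchingWeight, matchingWeight, hsplit, hsplit fun k => expWeight p (y k - x (_ : Fin n)),
    hrest]
  simp only [Equiv.Perm.mul_apply, Equiv.swap_apply_left, Equiv.swap_apply_right]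
  have := expWeight_add_lt h1 h2
  rw [hj] at this ⊢
  omega

/-- Two matchings of maximal weight assign to each `y i` the same point. -/
theorem maximal_matching_unique {p n : ℕ} [NeZero p] {y x : Fin n → ZMod p}
    (hy : Function.Injective y) (σ τ : Equiv.Perm (Fin n))
    (hσ : ∀ ρ, matchingWeight y x ρ ≤ matchingWeight y x σ)
    (hτ : ∀ ρ, matchingWeight y x ρ ≤ matchingWeight y x τ) (i : Fin n) :
    x (σ i) = x (τ i) := by
  by_contra hi
  -- At the smallest gap among all disagreements, the matching that does not attain it can be
  -- improved.
  obtain ⟨m, hm, hmin⟩ := (Finset.univ.filter fun i => x (σ i) ≠ x (τ i)).exists_min_image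
    (fun i => min (y i - x (σ i)).val (y i - x (τ i)).val) ⟨i, by simpa using hi⟩
  simp only [Finset.mem_filter, Finset.mem_univ, true_and] at hm hmin
  rcases le_total (y m - x (σ m)).val (y m - x (τ m)).val with h | h
  · obtain ⟨ρ, hρ⟩ := exists_matchingWeight_lt hy τ σ m hm.symm fun j hj => by
      have := hmin j hj.symm
      omega
    exact hρ.not_ge (hτ ρ)
  · obtain ⟨ρ, hρ⟩ := exists_matchingWeight_lt hy σ τ m hm fun j hj => by
      have := hmin j hj
      omega
    exact hρ.not_ge (hσ ρ)

/-! ### Nonvanishing of the minors as polynomials -/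

/-- Up to permutation the matrix is block diagonal, one block per value of `x`. The blocks are
square because `σ` is a bijection, and `chebotarev` kills a kernel vector on each. -/
theorem det_matching_block_ne_zero {p n : ℕ} [Fact p.Prime] {y x : Fin n → ZMod p} {z : Fin n → ℂ}
    (hy : Function.Injective y) (hz : ∀ j, z j ^ p = 1)
    (hxz : ∀ i j, x i = x j → z i = z j → i = j) (σ : Equiv.Perm (Fin n)) :
    (Matrix.of fun j i => if x j = x (σ i) then z j ^ (y i).val else 0).det ≠ 0 := by
  classical
  intro hdet
  obtain ⟨u, hu0, hu⟩ := Matrix.exists_mulVec_eq_zero_iff.2 hdet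
  refine hu0 (funext fun i₀ => ?_)
  set I := Finset.univ.filter fun i => x (σ i) = x (σ i₀) with hI
  set J := Finset.univ.filter fun j => x j = x (σ i₀) with hJ
  have hS : (I.image y).card = I.card := Finset.card_image_of_injective _ hy
  have hR : (J.image z).card = J.card := by
    refine Finset.card_image_of_injOn fun i hi j hj h => ?_
    simp only [hJ, Finset.coe_filter, Finset.mem_univ, true_and, Set.mem_ofPred_eq] at hi hj
    exact hxz i j (hi.trans hj.symm) h
  have key := chebotarev p (I.image y) (J.image z) (by simp [hz])
    (by rw [hS, hR, card_filter_comp_perm]) (Function.extend y u 0) ?_ (y i₀)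
    (Finset.mem_image_of_mem _ (by simp [hI]))
  · rwa [hy.extend_apply] at key
  · intro w hw
    obtain ⟨j, hj, rfl⟩ := Finset.mem_image.1 hw
    have hj : x j = x (σ i₀) := by simpa [hJ] using hj
    rw [Finset.sum_image hy.injOn]
    have h1 := congrFun hu j
    simp only [Matrix.mulVec, dotProduct, Matrix.of_apply, Pi.zero_apply, ite_mul, zero_mul] at h1
    rw [← Finset.sum_filter] at h1
    rw [← h1]
    refine Finset.sum_congr ?_ fun i _ => ?_
    · rw [hI]
      ext i
      simp [hj, eq_comm]
    · rw [hy.extend_apply, mul_comm]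

-- Only permutations agreeing with a heaviest `σ` after applying `x` reach its weight, so that
-- coefficient is the block determinant.
open Polynomial in
theorem det_monomial_ne_zero {p n : ℕ} [Fact p.Prime] {y x : Fin n → ZMod p} {z : Fin n → ℂ}
    (hy : Function.Injective y) (hz : ∀ j, z j ^ p = 1)
    (hxz : ∀ i j, x i = x j → z i = z j → i = j) :
    (Matrix.of fun j i => C (z j ^ (y i).val) * X ^ expWeight p (y i - x j)).det ≠ 0 := by
  classical
  obtain ⟨σ, -, hσ⟩ := Finset.univ.exists_max_image (matchingWeight y x) Finset.univ_nonempty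
  replace hσ : ∀ ρ, matchingWeight y x ρ ≤ matchingWeight y x σ := fun ρ => hσ ρ (Finset.mem_univ _)
  intro h
  apply det_matching_block_ne_zero hy hz hxz σ
  have hc := congrArg (fun q => coeff q (matchingWeight y x σ)) h
  simp only [coeff_zero] at hc
  refine Eq.trans ?_ hc
  rw [Matrix.det_apply, Matrix.det_apply, finsetSum_coeff]
  refine Finset.sum_congr rfl fun ρ _ => ?_
  rw [coeff_smul]
  congr 1
  simp only [Matrix.of_apply]
  rw [Finset.prod_mul_distrib, ← map_prod, Finset.prod_pow_eq_pow_sum, coeff_C_mul_X_pow]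
  by_cases hρ : ∀ i, x (ρ i) = x (σ i)
  · have : matchingWeight y x σ = ∑ i, expWeight p (y i - x (ρ i)) :=
      Finset.sum_congr rfl fun i _ => by rw [hρ i]
    rw [if_pos this]
    exact Finset.prod_congr rfl fun i _ => if_pos (hρ i)
  · have : matchingWeight y x σ ≠ ∑ i, expWeight p (y i - x (ρ i)) := fun he =>
      hρ (maximal_matching_unique hy ρ σ (fun π => (hσ π).trans he.le) hσ)
    rw [if_neg this]
    push Not at hρ
    obtain ⟨i, hi⟩ := hρ
    exact Finset.prod_eq_zero (Finset.mem_univ i) (if_neg hi)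

/-! ### Choice of the unimodular window -/

theorem conj_addChar_apply {p : ℕ} [Fact p.Prime] (ξ : AddChar (ZMod p) ℂ) (y : ZMod p) :
    conj (ξ y) = ξ (-1) ^ y.val := by
  rw [← AddChar.map_neg_eq_conj, ← AddChar.map_nsmul_eq_pow]
  congr 1
  simp

theorem addChar_neg_one_injective {p : ℕ} [Fact p.Prime] {ξ η : AddChar (ZMod p) ℂ}
    (h : ξ (-1) = η (-1)) : ξ = η := by
  ext y
  apply (starRingEnd ℂ).injective
  rw [conj_addChar_apply, conj_addChar_apply, h]

theorem addChar_neg_one_pow {p : ℕ} [Fact p.Prime] (ξ : AddChar (ZMod p) ℂ) :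
    ξ (-1) ^ p = 1 := by
  rw [← AddChar.map_nsmul_eq_pow]
  simp

theorem infinite_unit_circle : (Metric.sphere (0 : ℂ) 1).Infinite := by
  refine (isPreconnected_sphere (by simp [Complex.rank_real_complex]) 0 1).infinite_of_nontrivial ?_
  exact ⟨1, by simp, -1, by simp, by norm_num⟩

open Polynomial in
/-- There is a unimodular window for which every minor of the associated full Gabor system matrix
is nonzero. -/
theorem exists_window_minors_ne_zero (p : ℕ) [Fact p.Prime] :
    ∃ g : ZMod p → ℂ, (∀ x, ‖g x‖ = 1) ∧
      ∀ (n : ℕ) (y : Fin n → ZMod p) (lam : Fin n → ZMod p × AddChar (ZMod p) ℂ),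
        Function.Injective y → Function.Injective lam →
        (Matrix.of fun j i => conj (timeFreqShift (lam j) g (y i))).det ≠ 0 := by
  let P : ∀ n : ℕ, (Fin n → ZMod p) × (Fin n → ZMod p × AddChar (ZMod p) ℂ) → ℂ[X] := fun n q =>
    (Matrix.of fun j i => C ((q.2 j).2 (-1) ^ (q.1 i).val) *
      X ^ expWeight p (q.1 i - (q.2 j).1)).det
  -- Sizes `n ≤ p` suffice, since `y` is injective into `ZMod p`.
  have hfin : (⋃ n : Fin (p + 1), ⋃ q, {t : ℂ | P n q ≠ 0 ∧ (P n q).IsRoot t}).Finite := by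
    refine Set.finite_iUnion fun n => Set.finite_iUnion fun q => ?_
    by_cases hP : P n q = 0
    · simp [hP]
    · exact (finite_setOfPred_isRoot hP).subset fun t ht => ht.2
  obtain ⟨t, ht, hroot⟩ := infinite_unit_circle.exists_notMem_finite hfin
  have ht1 : ‖t‖ = 1 := by simpa using ht
  refine ⟨fun a => conj t ^ expWeight p a, fun x => by simp [ht1], ?_⟩
  intro n y lam hy hlam
  have hn : n < p + 1 := by
    have := Fintype.card_le_of_injective y hy
    rw [Fintype.card_fin, ZMod.card] at this
    omega
  have hP : P n (y, lam) ≠ 0 := det_monomial_ne_zero (x := fun j => (lam j).1)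
    (z := fun j => (lam j).2 (-1)) hy (fun j => addChar_neg_one_pow _)
    fun i j h1 h2 => hlam (Prod.ext h1 (addChar_neg_one_injective h2))
  simp only [Set.mem_iUnion, not_exists] at hroot
  have h := hroot ⟨n, hn⟩ (y, lam)
  intro hdet
  refine h ⟨hP, ?_⟩
  rw [IsRoot, ← coe_evalRingHom, RingHom.map_det, ← hdet]
  congr 1
  ext j i
  simp [timeFreqShift, modulation, translation, conj_addChar_apply]

/-! ### The uncertainty bound -/

theorem supportSize_eq_card {ι : Type*} [Fintype ι] (f : ι → ℂ) :
    supportSize f = (Finset.univ.filter fun i => f i ≠ 0).card := by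
  rw [supportSize, ← Set.ncard_coe_finset]
  congr 1
  ext i
  simp

theorem supportSize_add_card_zeros {ι : Type*} [Fintype ι] (f : ι → ℂ) :
    supportSize f + (Finset.univ.filter fun i => f i = 0).card = Fintype.card ι := by
  rw [supportSize_eq_card, add_comm, Finset.card_filter_add_card_filter_not, Finset.card_univ]

theorem card_timeFreq (p : ℕ) [Fact p.Prime] :
    Fintype.card (ZMod p × AddChar (ZMod p) ℂ) = p ^ 2 := by
  rw [Fintype.card_prod, AddChar.card_eq, ZMod.card, sq]

/-- If all minors of the Gabor system matrix of `g` are nonzero, then `g` satisfies the strong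
uncertainty principle. -/
theorem supportSize_add_supportSize_stft_ge {p : ℕ} [Fact p.Prime] {g : ZMod p → ℂ}
    (hg : ∀ (n : ℕ) (y : Fin n → ZMod p) (lam : Fin n → ZMod p × AddChar (ZMod p) ℂ),
        Function.Injective y → Function.Injective lam →
        (Matrix.of fun j i => conj (timeFreqShift (lam j) g (y i))).det ≠ 0)
    (f : ZMod p → ℂ) (hf : f ≠ 0) : p ^ 2 + 1 ≤ supportSize f + supportSize (stft g f) := by
  by_contra! hlt
  have hz := supportSize_add_card_zeros (stft g f)
  rw [card_timeFreq] at hz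
  have hA := supportSize_eq_card f
  set A := Finset.univ.filter fun i => f i ≠ 0 with hAdef
  -- If the bound fails, the transform has at least `|A|` zeros, so `f` restricted to `A` lies in
  -- the kernel of a square minor.
  obtain ⟨L, hL, hLcard⟩ := Finset.exists_subset_card_eq
    (s := Finset.univ.filter fun i => stft g f i = 0) (n := A.card) (by omega)
  let y : Fin A.card → ZMod p := fun i => A.equivFin.symm i
  let lam : Fin A.card → ZMod p × AddChar (ZMod p) ℂ := fun i => (L.equivFinOfCardEq hLcard).symm i
  have hy : Function.Injective y := Subtype.val_injective.comp (Equiv.injective _)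
  have hlam : Function.Injective lam := Subtype.val_injective.comp (Equiv.injective _)
  have hA0 : A.Nonempty := by
    obtain ⟨a, ha⟩ := Function.ne_iff.1 hf
    exact ⟨a, by simpa [hAdef] using ha⟩
  refine hg _ y lam hy hlam (Matrix.exists_mulVec_eq_zero_iff.1 ⟨fun i => f (y i), ?_, ?_⟩)
  · intro h
    have h0 := congrFun h ⟨0, hA0.card_pos⟩
    have := (A.equivFin.symm ⟨0, hA0.card_pos⟩).2
    exact (Finset.mem_filter.1 this).2 h0
  · ext j
    have hj : stft g f (lam j) = 0 := by
      have := hL ((L.equivFinOfCardEq hLcard).symm j).2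
      rw [Finset.mem_filter] at this
      exact this.2
    rw [Pi.zero_apply, ← hj]
    simp only [Matrix.mulVec, dotProduct, Matrix.of_apply, stft]
    rw [← Finset.sum_subset (Finset.subset_univ A) fun i _ hi => ?_]
    · rw [← Finset.sum_coe_sort A, ← A.equivFin.symm.sum_comp]
      exact Finset.sum_congr rfl fun i _ => mul_comm _ _
    · have : f i = 0 := by simpa [hAdef] using hi
      rw [this, zero_mul]

/-! ### Realizing all admissible support sizes -/

/-- The short-time Fourier transform at a point, as a linear functional. -/
noncomputable def stftDual {p : ℕ} [Fact p.Prime] (g : ZMod p → ℂ)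
    (lam : ZMod p × AddChar (ZMod p) ℂ) : Module.Dual ℂ (ZMod p → ℂ) where
  toFun f := stft g f lam
  map_add' f f' := by simp [stft, add_mul, Finset.sum_add_distrib]
  map_smul' c f := by simp [stft, Finset.mul_sum, mul_assoc]

@[simp] theorem stftDual_apply {p : ℕ} [Fact p.Prime] (g : ZMod p → ℂ)
    (lam : ZMod p × AddChar (ZMod p) ℂ) (f : ZMod p → ℂ) : stftDual g lam f = stft g f lam := rfl

theorem exists_ne_zero_supported_stft_eq_zero {p : ℕ} [Fact p.Prime] (g : ZMod p → ℂ)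
    (A : Finset (ZMod p)) (L : Finset (ZMod p × AddChar (ZMod p) ℂ)) (h : L.card < A.card) :
    ∃ f : ZMod p → ℂ, f ≠ 0 ∧ (∀ a ∉ A, f a = 0) ∧ ∀ lam ∈ L, stft g f lam = 0 := by
  let T : (ZMod p → ℂ) →ₗ[ℂ] (({a // a ∉ A} ⊕ L) → ℂ) := LinearMap.pi
    (Sum.elim (fun a => LinearMap.proj a.1) fun lam => stftDual g lam.1)
  have hT : LinearMap.ker T ≠ ⊥ := by
    apply T.ker_ne_bot_of_finrank_lt
    have : A.card ≤ Fintype.card (ZMod p) := Finset.card_le_univ A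
    rw [Module.finrank_fintype_fun_eq_card, Module.finrank_fintype_fun_eq_card, Fintype.card_sum,
      Fintype.card_coe, Fintype.card_subtype_compl, Fintype.card_coe]
    omega
  obtain ⟨f, hf, hf0⟩ := Submodule.exists_mem_ne_zero_of_ne_bot hT
  have hf := congrFun (LinearMap.mem_ker.1 hf)
  exact ⟨f, hf0, fun a ha => hf (Sum.inl ⟨a, ha⟩), fun lam hl => hf (Sum.inr ⟨lam, hl⟩)⟩

/-- Under the strong uncertainty principle, zeros of `f` and of its transform can be prescribed
exactly. -/
theorem exists_exact_supports {p : ℕ} [Fact p.Prime] {g : ZMod p → ℂ}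
    (hg : ∀ f : ZMod p → ℂ, f ≠ 0 → p ^ 2 + 1 ≤ supportSize f + supportSize (stft g f))
    (A : Finset (ZMod p)) (L : Finset (ZMod p × AddChar (ZMod p) ℂ)) (h : L.card < A.card)
    (hL : L.card < p ^ 2) :
    ∃ f : ZMod p → ℂ, (∀ a, f a ≠ 0 ↔ a ∈ A) ∧ ∀ lam, stft g f lam = 0 ↔ lam ∈ L := by
  classical
  have hAp : A.card ≤ p := (Finset.card_le_univ A).trans (ZMod.card p).le
  have hp : 1 ≤ p := (Fact.out : p.Prime).one_le
  have hpp : p ≤ p ^ 2 := Nat.le_self_pow two_ne_zero p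
  let W : Submodule ℂ (ZMod p → ℂ) :=
    (⨅ a ∈ (Aᶜ : Finset (ZMod p)), LinearMap.ker (LinearMap.proj a)) ⊓
      ⨅ lam ∈ L, LinearMap.ker (stftDual g lam)
  have hW : ∀ f, f ∈ W ↔ (∀ a ∉ A, f a = 0) ∧ ∀ lam ∈ L, stft g f lam = 0 := by
    intro f
    simp [W, Submodule.mem_iInf]
  have key : ∀ lam ∉ L, ∃ f ∈ W, (∀ a ∈ A, f a ≠ 0) ∧ stft g f lam ≠ 0 := by
    intro lam hlam
    -- With `|A| - 1` zeros imposed away from `lam`, the uncertainty bound is tight: the support is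
    -- all of `A` and the transform vanishes only on `M`.
    obtain ⟨M, hLM, hMl, hMc⟩ := Finset.exists_subsuperset_card_eq
      (s := L) (t := Finset.univ.erase lam) (n := A.card - 1)
      (fun μ hμ => Finset.mem_erase.2 ⟨fun h => hlam (h ▸ hμ), Finset.mem_univ _⟩) (by omega)
      (by rw [Finset.card_erase_of_mem (Finset.mem_univ _), Finset.card_univ, card_timeFreq]; omega)
    obtain ⟨f, hf0, hfA, hfM⟩ := exists_ne_zero_supported_stft_eq_zero g A M (by omega)
    refine ⟨f, (hW f).2 ⟨hfA, fun μ hμ => hfM μ (hLM hμ)⟩, ?_, ?_⟩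
    all_goals
      have h1 := hg f hf0
      have h2 := supportSize_add_card_zeros (stft g f)
      rw [card_timeFreq] at h2
      have hsub : M ⊆ Finset.univ.filter fun μ => stft g f μ = 0 := fun μ hμ => by simp [hfM μ hμ]
      have hsub' : (Finset.univ.filter fun a => f a ≠ 0) ⊆ A := fun a ha => by
        by_contra hcon
        simp [hfA a hcon] at ha
      have h3 := Finset.card_le_card hsub
      have h4 := Finset.card_le_card hsub'
      rw [supportSize_eq_card f] at h1
    · intro a ha
      rw [← Finset.eq_of_subset_of_card_le hsub' (by omega)] at ha
      exact (Finset.mem_filter.1 ha).2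
    · intro hl
      have : lam ∈ M := by
        rw [Finset.eq_of_subset_of_card_le hsub (by omega)]
        simp [hl]
      simpa using hMl this
  obtain ⟨lam₀, hlam₀⟩ : ∃ lam, lam ∉ L := by
    by_contra! hcon
    rw [(Finset.eq_univ_iff_forall).2 hcon, Finset.card_univ, card_timeFreq] at hL
    exact hL.false
  -- Finitely many functionals, each nonzero on `W`, are simultaneously nonzero at some vector of
  -- `W`, as `ℂ` is infinite.
  obtain ⟨f, hfW, hf⟩ := Module.Dual.exists_forall_mem_ne_zero_of_forall_exists W
    (Sum.elim (fun a : A => LinearMap.proj a.1)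
      fun lam : {lam // lam ∉ L} => stftDual g lam.1) (by
        rintro (⟨a, ha⟩ | ⟨lam, hl⟩)
        · obtain ⟨f, hfW, hf, -⟩ := key lam₀ hlam₀
          exact ⟨f, hfW, hf a ha⟩
        · obtain ⟨f, hfW, -, hf⟩ := key lam hl
          exact ⟨f, hfW, hf⟩)
  obtain ⟨h1, h2⟩ := (hW f).1 hfW
  refine ⟨f, fun a => ⟨fun ha => by_contra fun h => ha (h1 a h), fun ha => hf (Sum.inl ⟨a, ha⟩)⟩,
    fun lam => ⟨fun hl => by_contra fun h => hf (Sum.inr ⟨lam, h⟩) hl, h2 lam⟩⟩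

theorem mainTheorem7 (p : ℕ) [Fact p.Prime] :
    ∃ g : ZMod p → ℂ,
      (∀ x : ZMod p, ‖g x‖ = 1) ∧
      (∀ f : ZMod p → ℂ, f ≠ 0 → p ^ 2 + 1 ≤ supportSize f + supportSize (stft g f)) ∧
      (∀ k l : ℕ, 1 ≤ k → k ≤ p → 1 ≤ l → l ≤ p ^ 2 → p ^ 2 + 1 ≤ k + l →
        ∃ f : ZMod p → ℂ, supportSize f = k ∧ supportSize (stft g f) = l) := by
  obtain ⟨g, hg1, hg⟩ := exists_window_minors_ne_zero p
  have hunc := supportSize_add_supportSize_stft_ge hg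
  refine ⟨g, hg1, hunc, fun k l hk hkp hl hlp hkl => ?_⟩
  obtain ⟨A, -, hA⟩ := Finset.exists_subset_card_eq (s := (Finset.univ : Finset (ZMod p))) (n := k)
    (by rwa [Finset.card_univ, ZMod.card])
  obtain ⟨L, -, hL⟩ := Finset.exists_subset_card_eq
    (s := (Finset.univ : Finset (ZMod p × AddChar (ZMod p) ℂ))) (n := p ^ 2 - l)
    (by rw [Finset.card_univ, card_timeFreq]; omega)
  obtain ⟨f, hfA, hfL⟩ := exists_exact_supports hunc A L (by omega) (by omega)
  refine ⟨f, ?_, ?_⟩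
  · rw [supportSize_eq_card, ← hA]
    congr 1
    ext a
    simp [hfA a]
  · have h := supportSize_add_card_zeros (stft g f)
    rw [card_timeFreq] at h
    have hLz : (Finset.univ.filter fun lam => stft g f lam = 0) = L := by
      ext lam
      simp [hfL lam]
    rw [hLz] at h
    omega
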